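/- Let $d\ge 1$, let $M_d$ be the space of complex $d\times d$ matrices and let $\|X\|_1=\operatorname{tr}\sqrt{X^*X}$ be the trace norm. For a positive trace-preserving linear map $T:M_d\to M_d$ put \[ \kappa_{\rm tr}(T)=\sup\Big\{\tfrac{\|T(X)\|_1}{\|X\|_1} : X=X^*,\ \operatorname{tr}X=0,\ X\neq 0\Big\}\in[0,1] \] (the supremum of the empty set, which occurs for $d=1$, being $0$). Let $(\Omega,\mathcal F,\mathbb P)$ be a probability space, let $\theta:\Omega\to\Omega$ be an invertible probability-preserving transformation (a bijection, measurable together with its inverse, that preserves $\mathbb P$), and let $\omega\mapsto\Phi_\omega$ be a measurable map from $\Omega$ into the finite-dimensional space of linear maps on $M_d$ such that every $\Phi_\omega$ is completely positive and trace preserving. For $n\ge1$ set \[ \Phi^{(n)}_\omega=\Phi_{\theta^{n-1}\omega}\circ\cdots\circ\Phi_{\theta\omega}\circ\Phi_\omega,\qquad \kappa_n(\omega)=\kappa_{\rm tr}(\Phi^{(n)}_\omega), \] and use the conventions $\log 0=-\infty$ and $\mathbb E[F]=-\mathbb E[-F]\in[-\infty,0]$ for random variables $F$ with values in $[-\infty,0]$.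 Then there exists a $\theta$-invariant random variable $\lambda_{\rm tr}:\Omega\to[-\infty,0]$ such that \[ \lambda_{\rm tr}(\omega)=\lim_{n\to\infty}\frac1n\log\kappa_n(\omega)\qquad\text{for }\mathbb P\text{-a.e. }\omega . \] If $\theta$ is ergodic, then $\lambda_{\rm tr}$ is almost surely equal to a constant, and this constant equals \[ \inf_{n\ge1}\frac1n\,\mathbb E[\log\kappa_n]\in[-\infty,0]. \] -/

import Mathlib

open MeasureTheory Filter Topology
open scoped ENNReal

noncomputable section

/-- The complex `d × d` matrices. -/
abbrev Mat (d : ℕ) : Type := Matrix (Fin d) (Fin d) ℂ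

/-- Linear maps on the complex `d × d` matrices. -/
abbrev SuperOp (d : ℕ) : Type := Mat d →ₗ[ℂ] Mat d

open scoped MatrixOrder Matrix.Norms.L2Operator in
/-- The trace norm `‖X‖₁ = tr |X|`, where `|X| = (X* X)^(1/2)`. -/
def traceNorm {d : ℕ} (X : Mat d) : ℝ := (CFC.abs X).trace.re

open scoped MatrixOrder Matrix.Norms.L2Operator CStarAlgebra in
/-- A linear map on matrices is CPTP if it is completely positive (here with `Mat d` as the usual
C*-algebra, with the positive semidefinite order) and trace preserving. -/
def IsCPTP {d : ℕ} (T : SuperOp d) : Prop :=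
  (∃ Ψ : Mat d →CP Mat d, Ψ.toLinearMap = T) ∧ ∀ X : Mat d, (T X).trace = X.trace

/-- The centered trace-Dobrushin coefficient: the supremum of `‖T X‖₁ / ‖X‖₁` over the nonzero
self-adjoint matrices `X` of trace zero. The supremum is taken in `[0, ∞]`, so that it is the
true supremum for every `T`. -/
def kappaTr {d : ℕ} (T : SuperOp d) : ℝ≥0∞ :=
  ⨆ X : {X : Mat d // X.IsHermitian ∧ X.trace = 0 ∧ X ≠ 0},
    ENNReal.ofReal (traceNorm (T X.1) / traceNorm X.1)

/-- The forward product `Φ_{θ^(n-1) ω} ∘ ⋯ ∘ Φ_{θ ω} ∘ Φ_ω`; the empty product is the identity. -/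
def forwardProduct {Ω : Type*} {d : ℕ} (θ : Ω → Ω) (Φ : Ω → SuperOp d) : ℕ → Ω → SuperOp d
  | 0, _ => LinearMap.id
  | n + 1, ω => Φ (θ^[n] ω) ∘ₗ forwardProduct θ Φ n ω

/-- `log κ_n(ω)`, with values in `[-∞, ∞]` and `log 0 = -∞`, where `κ_n(ω)` is the trace-Dobrushin
coefficient of the `n`-step forward product. -/
def logKappa {Ω : Type*} {d : ℕ} (θ : Ω → Ω) (Φ : Ω → SuperOp d) (n : ℕ) (ω : Ω) : EReal :=
  ENNReal.log (kappaTr (forwardProduct θ Φ n ω))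

/-- Expectation of a nonpositive extended random variable: `E[F] = -E[-F]`, in `[-∞, 0]`. -/
def nonposExpectation {Ω : Type*} [MeasurableSpace Ω] (P : Measure Ω) (F : Ω → EReal) : EReal :=
  -((∫⁻ ω, (-F ω).toENNReal ∂P : ℝ≥0∞) : EReal)

end

/-! Positive trace-preserving maps keep the traceless Hermitian matrices invariant and contract the
trace norm there, so `kappaTr` is submultiplicative and at most 1. Hence `-log κ_n` is a
superadditive process with values in `[0, ∞]`, and the theorem is Kingman's theorem for such
processes; allowing `∞` makes integrability assumptions unnecessary.

For Kingman, let `G` be the limsup of `f n / n`; it is a.e. invariant. If `c < G`, then almost every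
orbit point starts a block on which `f` grows at rate at least `c`. Points with no such block of
length at most `N` form sets shrinking to `∅`, so by the maximal inequality they are visited rarely
once `N` is large. Tiling the orbit by good blocks (`mul_sum_le_of_superadditive`) gives `c ≤
liminf`. The mean of `G` is bounded above by Fatou, and below by reverse Fatou for truncated block
sums. -/

/-- If a superadditive array is at least `c * n` over some block of length `n ≤ N` starting at each
marked point, then over a window it is at least `c` times the number of marked points, up to an
error `c * N`. -/
theorem mul_sum_le_of_superadditive {a : ℕ → ℕ → ℝ≥0∞}
    (ha : ∀ i m n, a i m + a (i + m) n ≤ a i (m + n)) {b : ℕ → ℝ≥0∞} (hb : ∀ i, b i ≤ 1)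
    {c : ℝ≥0∞} {N : ℕ} (h : ∀ i, b i ≠ 0 → ∃ n, 1 ≤ n ∧ n ≤ N ∧ c * n ≤ a i n) (L i : ℕ) :
    c * ∑ j ∈ Finset.range L, b (i + j) ≤ a i L + c * N := by
  have hcard : ∀ k i, ∑ j ∈ Finset.range k, b (i + j) ≤ k := fun k i => by
    simpa using Finset.sum_le_sum (s := Finset.range k) fun j _ => hb (i + j)
  induction L using Nat.strong_induction_on generalizing i with
  | _ L ih =>
    -- A window no longer than `N` is paid for by the error term. Otherwise an unmarked point is
    -- skipped, and a marked point is passed by jumping over its block.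
    rcases le_or_gt L N with hL | hL
    · calc c * ∑ j ∈ Finset.range L, b (i + j) ≤ c * L := by gcongr; exact hcard L i
        _ ≤ c * N := by gcongr
        _ ≤ _ := le_add_self
    · by_cases hi : b i = 0
      · obtain ⟨K, rfl⟩ : ∃ K, L = 1 + K := ⟨L - 1, by omega⟩
        have hsum : ∑ j ∈ Finset.range (1 + K), b (i + j)
            = ∑ j ∈ Finset.range K, b (i + 1 + j) := by
          rw [Finset.sum_range_add]; simp [hi, add_assoc]
        rw [hsum]
        calc _ ≤ a (i + 1) K + c * N := ih K (by omega) _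
          _ ≤ a i (1 + K) + c * N := by
            gcongr
            exact le_add_self.trans (ha i 1 K)
      · obtain ⟨n, h1, h2, h3⟩ := h i hi
        obtain ⟨K, rfl⟩ : ∃ K, L = n + K := ⟨L - n, by omega⟩
        rw [Finset.sum_range_add, mul_add]
        calc _ ≤ c * n + c * ∑ j ∈ Finset.range K, b (i + n + j) := by
              simp only [add_assoc]
              gcongr
              exact hcard n i
          _ ≤ a i n + (a (i + n) K + c * N) := by
              gcongr
              exact ih K (by omega) _
          _ ≤ _ := by
              rw [← add_assoc]
              gcongr
              exact ha i n K

/-! ### Kingman's theorem for `[0, ∞]`-valued superadditive processes. -/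

section Kingman

variable {Ω : Type*} {θ : Ω → Ω}

/-- A nonnegative process that is superadditive along the orbits of `θ`. -/
def IsSuperadditiveProcess (θ : Ω → Ω) (f : ℕ → Ω → ℝ≥0∞) : Prop :=
  ∀ m n ω, f m ω + f n (θ^[m] ω) ≤ f (m + n) ω

theorem isSuperadditiveProcess_birkhoffSum (h : Ω → ℝ≥0∞) :
    IsSuperadditiveProcess θ (birkhoffSum θ h) :=
  fun m n ω => (birkhoffSum_add θ h m n ω).ge

theorem IsSuperadditiveProcess.orbit {f : ℕ → Ω → ℝ≥0∞}
    (hf : IsSuperadditiveProcess θ f) (ω : Ω)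
    (i m n : ℕ) : f m (θ^[i] ω) + f n (θ^[i + m] ω) ≤ f (m + n) (θ^[i] ω) := by
  rw [add_comm i m, Function.iterate_add_apply]
  exact hf m n _

variable {f : ℕ → Ω → ℝ≥0∞}

/-- The upper growth rate of a process. -/
noncomputable def upperRate (f : ℕ → Ω → ℝ≥0∞) (ω : Ω) : ℝ≥0∞ :=
  limsup (fun n : ℕ => f n ω / n) atTop

/-- Since `f n (θ ω) ≤ f (n + 1) ω`, the two rates differ only by the factor `(n + 1) / n`, which
tends to 1. -/
theorem IsSuperadditiveProcess.upperRate_comp_le (hs : IsSuperadditiveProcess θ f) (ω : Ω) :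
    upperRate f (θ ω) ≤ upperRate f ω := by
  set u : ℕ → ℝ≥0∞ := fun n => f (n + 1) ω / (n + 1 : ℕ) with hu
  set v : ℕ → ℝ≥0∞ := fun n => 1 + 1 / n with hv
  have hv1 : limsup v atTop = 1 := by
    have : Tendsto v atTop (𝓝 (1 + 0)) := tendsto_const_nhds.add (by
      simpa using ENNReal.tendsto_inv_nat_nhds_zero)
    simpa using this.limsup_eq
  have hu1 : limsup u atTop = upperRate f ω := limsup_nat_add (fun n : ℕ => f n ω / n) 1
  calc upperRate f (θ ω) ≤ limsup (u * v) atTop := by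
        refine limsup_le_limsup ?_
        filter_upwards [eventually_ge_atTop 1] with n hn
        have h0 : (n : ℝ≥0∞) ≠ 0 := by simp; omega
        have ht : (n : ℝ≥0∞) ≠ ∞ := by simp
        have h0' : ((n + 1 : ℕ) : ℝ≥0∞) ≠ 0 := by simp
        have ht' : ((n + 1 : ℕ) : ℝ≥0∞) ≠ ∞ := by simp
        have hvn : v n = (n + 1 : ℕ) / n := by
          simp only [hv, Nat.cast_add, Nat.cast_one, ENNReal.add_div, ENNReal.div_self h0 ht]
        have hle : f n (θ ω) ≤ f (n + 1) ω := by
          have := hs 1 n ω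
          rw [add_comm 1 n] at this
          exact le_add_self.trans this
        rw [Pi.mul_apply, hvn, hu, ← mul_div_assoc, ENNReal.div_mul_cancel h0' ht']
        gcongr
    _ ≤ limsup u atTop * limsup v atTop :=
        ENNReal.limsup_mul_le' (by simp [hv1]) (by simp [hv1])
    _ = upperRate f ω := by rw [hv1, hu1, mul_one]

theorem IsSuperadditiveProcess.birkhoffSum_le (hs : IsSuperadditiveProcess θ f) (m k : ℕ) (ω : Ω) :
    birkhoffSum θ^[m] (f m) k ω ≤ f (m * k) ω := by
  induction k with
  | zero => simp
  | succ k ih =>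
    rw [birkhoffSum_succ, mul_add, mul_one, ← Function.iterate_mul]
    exact (add_le_add_left ih _).trans (hs (m * k) m ω)

variable [MeasurableSpace Ω] {P : Measure Ω}

theorem measurable_birkhoffSum (hθ : Measurable θ) {h : Ω → ℝ≥0∞} (hh : Measurable h) (n : ℕ) :
    Measurable (birkhoffSum θ h n) :=
  Finset.measurable_fun_sum _ fun i _ => hh.comp (hθ.iterate i)

theorem lintegral_birkhoffSum (hθ : MeasurePreserving θ P P) {h : Ω → ℝ≥0∞} (hh : Measurable h)
    (n : ℕ) : ∫⁻ ω, birkhoffSum θ h n ω ∂P = n * ∫⁻ ω, h ω ∂P := by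
  simp only [birkhoffSum]
  rw [lintegral_finsetSum _ fun i _ => by exact hh.comp (hθ.measurable.iterate i)]
  simp [(hθ.iterate _).lintegral_comp hh]

/-- An additive constant can be absorbed: if `L * x ≤ L * y + C` for all `L`, then `x ≤ y`. -/
theorem le_of_forall_natCast_mul_le_add {x y C : ℝ≥0∞} (hC : C ≠ ∞)
    (h : ∀ L : ℕ, L * x ≤ L * y + C) : x ≤ y := by
  have hlim : Tendsto (fun L : ℕ => y + C / L) atTop (𝓝 (y + 0)) :=
    tendsto_const_nhds.add (ENNReal.Tendsto.const_div ENNReal.tendsto_nat_nhds_top (Or.inr hC)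
      |>.trans (by simp))
  rw [add_zero] at hlim
  refine ge_of_tendsto hlim ?_
  filter_upwards [eventually_ge_atTop 1] with L hL
  have h0 : (L : ℝ≥0∞) ≠ 0 := by simp; omega
  have ht : (L : ℝ≥0∞) ≠ ∞ := by simp
  calc x = (L * x) / L := by rw [mul_comm, ENNReal.mul_div_cancel_right h0 ht]
    _ ≤ (L * y + C) / L := by gcongr; exact h L
    _ = y + C / L := by rw [ENNReal.add_div, mul_comm, ENNReal.mul_div_cancel_right h0 ht]

/-- The maximal ergodic inequality for nonnegative functions. -/
theorem mul_measure_exists_le_birkhoffSum_le [IsProbabilityMeasure P]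
    (hθ : MeasurePreserving θ P P) {h : Ω → ℝ≥0∞} (hh : Measurable h) {α : ℝ≥0∞} (hα : α ≠ ∞) :
    α * P {ω | ∃ n : ℕ, 1 ≤ n ∧ α * n ≤ birkhoffSum θ h n ω} ≤ ∫⁻ ω, h ω ∂P := by
  set E : ℕ → Set Ω := fun N => {ω | ∃ n : ℕ, 1 ≤ n ∧ n ≤ N ∧ α * n ≤ birkhoffSum θ h n ω}
    with hE
  have hEm : ∀ N, MeasurableSet (E N) := fun N => by
    have : E N = ⋃ n ∈ Finset.Icc 1 N, {ω | α * n ≤ birkhoffSum θ h n ω} := by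
      ext ω; simp [hE, and_assoc]
    rw [this]
    exact Finset.measurableSet_biUnion _ fun n _ =>
      measurableSet_le measurable_const (measurable_birkhoffSum hθ.measurable hh n)
  have hEmono : Monotone E := fun M N hMN ω ⟨n, h1, h2, h3⟩ => ⟨n, h1, h2.trans hMN, h3⟩
  have hEU : {ω | ∃ n : ℕ, 1 ≤ n ∧ α * n ≤ birkhoffSum θ h n ω} = ⋃ N, E N := by
    ext ω
    simp only [hE, Set.mem_ofPred_eq, Set.mem_iUnion]
    exact ⟨fun ⟨n, h1, h2⟩ => ⟨n, n, h1, le_rfl, h2⟩, fun ⟨_, n, h1, _, h2⟩ => ⟨n, h1, h2⟩⟩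
  rw [hEU, hEmono.measure_iUnion, ENNReal.mul_iSup]
  -- The tiling bound is integrated over windows of length `L`; the error `α * N` does not grow with
  -- `L`.
  refine iSup_le fun N => le_of_forall_natCast_mul_le_add (C := α * N)
    (ENNReal.mul_ne_top hα (by simp)) fun L => ?_
  have hi : Measurable ((E N).indicator (1 : Ω → ℝ≥0∞)) := measurable_one.indicator (hEm N)
  have key : ∀ ω, α * birkhoffSum θ ((E N).indicator 1) L ω ≤ birkhoffSum θ h L ω + α * N := by
    intro ω
    have := mul_sum_le_of_superadditive (a := fun i n => birkhoffSum θ h n (θ^[i] ω))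
      ((isSuperadditiveProcess_birkhoffSum h).orbit ω)
      (b := fun i => (E N).indicator (1 : Ω → ℝ≥0∞) (θ^[i] ω))
      (fun i => Set.indicator_le' (fun _ _ => le_rfl) (fun _ _ => zero_le_one) _)
      (c := α) (N := N) (fun i hi => by simpa [hE] using Set.mem_of_indicator_ne_zero hi) L 0
    simpa [birkhoffSum] using this
  calc L * (α * P (E N)) = ∫⁻ ω, α * birkhoffSum θ ((E N).indicator 1) L ω ∂P := by
        rw [lintegral_const_mul _ (measurable_birkhoffSum hθ.measurable hi L),
          lintegral_birkhoffSum hθ hi, lintegral_indicator_one (hEm N)]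
        ring
    _ ≤ ∫⁻ ω, (birkhoffSum θ h L ω + α * N) ∂P := lintegral_mono key
    _ = L * ∫⁻ ω, h ω ∂P + α * N := by
        rw [lintegral_add_right _ measurable_const, lintegral_birkhoffSum hθ hh]
        simp

/-- If `B N` decreases to a null set, then at almost every point the upper densities of visits to
`B N` are eventually below any given level. -/
theorem ae_exists_birkhoffSum_indicator_lt [IsProbabilityMeasure P]
    (hθ : MeasurePreserving θ P P) {B : ℕ → Set Ω} (hB : ∀ N, MeasurableSet (B N))
    (hlim : Tendsto (fun N => P (B N)) atTop (𝓝 0)) {α : ℝ≥0∞} (h0 : α ≠ 0) (hα : α ≠ ∞) :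
    ∀ᵐ ω ∂P, ∃ N, ∀ n : ℕ, 1 ≤ n → birkhoffSum θ ((B N).indicator 1) n ω < α * n := by
  rw [ae_iff]
  -- For every `N`, the exceptional set lies in the maximal set of the indicator of `B N`, of
  -- measure at most `α⁻¹ * P (B N)`.
  refine le_antisymm (ge_of_tendsto' (x := atTop) (f := fun N => α⁻¹ * P (B N)) ?_ fun N => ?_)
    zero_le
  · simpa using ENNReal.Tendsto.const_mul hlim (Or.inr (ENNReal.inv_ne_top.2 h0))
  · rw [← ENNReal.mul_le_iff_le_inv h0 hα, ← lintegral_indicator_one (hB N)]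
    refine le_trans ?_ (mul_measure_exists_le_birkhoffSum_le hθ
      (measurable_one.indicator (hB N)) hα)
    gcongr
    rintro hω
    push Not at hω
    exact hω N

theorem measurable_upperRate (hf : ∀ n, Measurable (f n)) : Measurable (upperRate f) :=
  Measurable.limsup fun n => (hf n).div_const _


/-- A measurable function that does not increase along a measure preserving map is almost surely
constant along its orbits. -/
theorem ae_forall_iterate_eq_of_comp_le [IsFiniteMeasure P] (hθ : MeasurePreserving θ P P)
    {G : Ω → ℝ≥0∞} (hG : Measurable G) (hle : ∀ ω, G (θ ω) ≤ G ω) :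
    ∀ᵐ ω ∂P, ∀ i, G (θ^[i] ω) = G ω := by
  have h1 : ∀ q : ℚ, ∀ᵐ ω ∂P, ENNReal.ofReal q < G ω → ENNReal.ofReal q < G (θ ω) := fun q => by
    have hm : MeasurableSet {ω | ENNReal.ofReal q < G ω} := measurableSet_lt measurable_const hG
    have := ae_eq_of_subset_of_measure_ge
      -- The preimage of a superlevel set is contained in it and has the same finite measure, so the
      -- two agree a.e.
      (s := θ ⁻¹' {ω | ENNReal.ofReal q < G ω}) (t := {ω | ENNReal.ofReal q < G ω})
      (μ := P) (fun ω hω => lt_of_lt_of_le hω (hle ω))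
      (hθ.measure_preimage hm.nullMeasurableSet).ge
      (hθ.measurable hm).nullMeasurableSet (measure_ne_top _ _)
    filter_upwards [this.mem_iff] with ω hω
    exact hω.2
  have h2 : ∀ᵐ ω ∂P, G (θ ω) = G ω := by
    filter_upwards [ae_all_iff.2 h1] with ω hω
    refine le_antisymm (hle ω) (le_of_not_gt fun hlt => ?_)
    obtain ⟨q, -, hq1, hq2⟩ := ENNReal.lt_iff_exists_rat_btwn.1 hlt
    exact lt_asymm hq1 (hω q hq2)
  have h3 : ∀ i, ∀ᵐ ω ∂P, G (θ (θ^[i] ω)) = G (θ^[i] ω) := fun i =>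
    (hθ.iterate i).quasiMeasurePreserving.ae h2
  filter_upwards [ae_all_iff.2 h3] with ω hω i
  induction i with
  | zero => rfl
  | succ i ih => rw [Function.iterate_succ_apply', hω, ih]

/-- Core of Kingman's theorem: `B N` collects the points where the rate exceeds `c` but no block of
length at most `N` shows it. -/
theorem ae_le_liminf_of_lt_upperRate [IsProbabilityMeasure P] (hθ : MeasurePreserving θ P P)
    (hf : ∀ n, Measurable (f n)) (hs : IsSuperadditiveProcess θ f) {c : ℝ≥0∞} (hc : c ≠ ∞) :
    ∀ᵐ ω ∂P, c < upperRate f ω → c ≤ liminf (fun n : ℕ => f n ω / n) atTop := by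
  have hG := measurable_upperRate hf
  set B : ℕ → Set Ω := fun N =>
    {ω | c < upperRate f ω ∧ ∀ n : ℕ, 1 ≤ n → n ≤ N → f n ω < c * n} with hBdef
  have hBm : ∀ N, MeasurableSet (B N) := fun N => by
    have : B N = {ω | c < upperRate f ω} ∩ ⋂ n ∈ Finset.Icc 1 N, {ω | f n ω < c * n} := by
      ext ω; simp [hBdef]
    rw [this]
    exact (measurableSet_lt measurable_const hG).inter
      (Finset.measurableSet_biInter _ fun n _ => measurableSet_lt (hf n) measurable_const)
  have hBanti : Antitone B := fun M N hMN ω hω =>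
    ⟨hω.1, fun n h1 h2 => hω.2 n h1 (h2.trans hMN)⟩
  have hBempty : ⋂ N, B N = ∅ := by
    refine Set.eq_empty_of_forall_notMem fun ω hω => ?_
    rw [Set.mem_iInter] at hω
    have hfr : ∃ᶠ n : ℕ in atTop, c < f n ω / n :=
      frequently_lt_of_lt_limsup (by isBoundedDefault) (hω 0).1
    obtain ⟨n, hn1, hn2⟩ := (frequently_atTop.1 hfr) 1
    refine absurd ((hω n).2 n hn1 le_rfl) (not_lt.2 ?_)
    exact ENNReal.mul_le_of_le_div hn2.le
  have hBlim : Tendsto (fun N => P (B N)) atTop (𝓝 0) := by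
    have := tendsto_measure_iInter_atTop (μ := P) (fun N => (hBm N).nullMeasurableSet) hBanti
      ⟨0, measure_ne_top _ _⟩
    rwa [hBempty, measure_empty] at this
  have hfew : ∀ k : ℕ, ∀ᵐ ω ∂P, ∃ N, ∀ n : ℕ, 1 ≤ n →
      birkhoffSum θ ((B N).indicator 1) n ω < (1 / (k + 1 : ℕ) : ℝ≥0∞) * n := fun k =>
    ae_exists_birkhoffSum_indicator_lt hθ hBm hBlim (by simp) (by simp)
  filter_upwards [ae_all_iff.2 hfew, ae_forall_iterate_eq_of_comp_le hθ hG hs.upperRate_comp_le]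
    with ω hω hinv hcω
  -- With `α = 1 / (k + 1)`, one `α` absorbs `c * N / L` and `c * α` absorbs the visits to `B N`.
  have hmain : ∀ k : ℕ, c ≤ liminf (fun n : ℕ => f n ω / n) atTop
      + (c + 1) * (1 / (k + 1 : ℕ) : ℝ≥0∞) := fun k => by
    obtain ⟨N, hN⟩ := hω k
    set α : ℝ≥0∞ := 1 / (k + 1 : ℕ) with hα
    have hα0 : 0 < α := by simp [hα]
    rw [← tsub_le_iff_right]
    have hlim : Tendsto (fun L : ℕ => c * N / L) atTop (𝓝 0) := by
      simpa using ENNReal.Tendsto.const_div (a := c * N) ENNReal.tendsto_nat_nhds_top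
        (Or.inr (ENNReal.mul_ne_top hc (by simp)))
    refine le_liminf_of_le (by isBoundedDefault) ?_
    filter_upwards [eventually_ge_atTop 1, hlim.eventually_lt_const hα0] with L hL1 hL2
    have h0 : (L : ℝ≥0∞) ≠ 0 := by simp; omega
    have ht : (L : ℝ≥0∞) ≠ ∞ := by simp
    have htile : c * birkhoffSum θ ((B N)ᶜ.indicator 1) L ω ≤ f L ω + c * N := by
      have := mul_sum_le_of_superadditive (a := fun i n => f n (θ^[i] ω)) (hs.orbit ω)
        (b := fun i => (B N)ᶜ.indicator (1 : Ω → ℝ≥0∞) (θ^[i] ω))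
        (fun i => Set.indicator_le' (fun _ _ => le_rfl) (fun _ _ => zero_le_one) _)
        -- Invariance of the rate gives `c < upperRate f` at every orbit point, so a point outside
        -- `B N` starts a good block.
        (c := c) (N := N) (fun i hi => by
          have hi := Set.mem_of_indicator_ne_zero hi
          by_contra hcon
          push Not at hcon
          exact hi ⟨by rwa [hinv i], hcon⟩) L 0
      simpa [birkhoffSum] using this
    have hsum : birkhoffSum θ ((B N)ᶜ.indicator 1) L ω
        + birkhoffSum θ ((B N).indicator 1) L ω = (L : ℝ≥0∞) := by
      simp only [birkhoffSum, ← Finset.sum_add_distrib]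
      have : ∀ x, (B N)ᶜ.indicator (1 : Ω → ℝ≥0∞) x + (B N).indicator 1 x = 1 := fun x =>
        congrFun (Set.indicator_compl_add_self (B N) (1 : Ω → ℝ≥0∞)) x
      simp [this]
    have h4 : c * L ≤ f L ω + c * N + c * (α * L) := by
      rw [← hsum, mul_add]
      rw [hsum]
      gcongr
      exact (hN L hL1).le
    rw [tsub_le_iff_right]
    calc c = c * L / L := (ENNReal.mul_div_cancel_right h0 ht).symm
      _ ≤ (f L ω + c * N + c * (α * L)) / L := by gcongr
      _ = f L ω / L + c * N / L + c * α := by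
        rw [ENNReal.add_div, ENNReal.add_div, ← mul_assoc, ENNReal.mul_div_cancel_right h0 ht]
      _ ≤ f L ω / L + α + c * α := by gcongr
      _ = _ := by ring
  have hlim : Tendsto (fun k : ℕ => liminf (fun n : ℕ => f n ω / n) atTop
      + (c + 1) * (1 / (k + 1 : ℕ) : ℝ≥0∞)) atTop
      (𝓝 (liminf (fun n : ℕ => f n ω / n) atTop + (c + 1) * 0)) := by
    refine tendsto_const_nhds.add (ENNReal.Tendsto.const_mul ?_
      (Or.inr (ENNReal.add_ne_top.2 ⟨hc, ENNReal.one_ne_top⟩)))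
    have := (tendsto_add_atTop_iff_nat 1).2 ENNReal.tendsto_inv_nat_nhds_zero
    simpa only [one_div] using this
  rw [mul_zero, add_zero] at hlim
  exact ge_of_tendsto' hlim hmain

/-- The subadditive ergodic theorem, for nonnegative superadditive processes. -/
theorem IsSuperadditiveProcess.ae_tendsto [IsProbabilityMeasure P] (hθ : MeasurePreserving θ P P)
    (hf : ∀ n, Measurable (f n)) (hs : IsSuperadditiveProcess θ f) :
    ∀ᵐ ω ∂P, Tendsto (fun n : ℕ => f n ω / n) atTop (𝓝 (upperRate f ω)) := by
  have h := fun q : ℚ => ae_le_liminf_of_lt_upperRate hθ hf hs (c := ENNReal.ofReal q)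
    ENNReal.ofReal_ne_top
  filter_upwards [ae_all_iff.2 h] with ω hω
  refine tendsto_of_le_liminf_of_limsup_le (le_of_not_gt fun hlt => ?_) le_rfl
  obtain ⟨q, -, hq1, hq2⟩ := ENNReal.lt_iff_exists_rat_btwn.1 hlt
  exact absurd (hω q hq2) (not_le.2 hq1)

/-- The mean of the limiting growth rate of a nonnegative superadditive process. -/
theorem IsSuperadditiveProcess.lintegral_upperRate [IsProbabilityMeasure P]
    (hθ : MeasurePreserving θ P P) (hf : ∀ n, Measurable (f n))
    (hs : IsSuperadditiveProcess θ f) :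
    ∫⁻ ω, upperRate f ω ∂P = ⨆ (n : ℕ) (_ : 1 ≤ n), (∫⁻ ω, f n ω ∂P) / n := by
  refine le_antisymm ?_ (iSup₂_le fun m hm => ?_)
  · calc ∫⁻ ω, upperRate f ω ∂P = ∫⁻ ω, liminf (fun n : ℕ => f n ω / n) atTop ∂P :=
          lintegral_congr_ae <| (hs.ae_tendsto hθ hf).mono fun ω hω => hω.liminf_eq.symm
      _ ≤ liminf (fun n : ℕ => ∫⁻ ω, f n ω / n ∂P) atTop :=
          lintegral_liminf_le fun n => (hf n).div_const _
      _ ≤ _ := by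
          refine liminf_le_of_le (by isBoundedDefault) fun b hb => ?_
          obtain ⟨n, hn, hn1⟩ := (hb.and (eventually_ge_atTop 1)).exists
          refine hn.trans (le_trans ?_ (le_iSup₂ n hn1))
          simp only [div_eq_mul_inv]
          rw [lintegral_mul_const _ (hf n)]
  · have h0 : (m : ℝ≥0∞) ≠ 0 := by simp; omega
    have ht : (m : ℝ≥0∞) ≠ ∞ := by simp
    rw [ENNReal.div_le_iff h0 ht]
    -- Reverse Fatou needs an integrable bound, whence the truncation at `M`, removed at the end by
    -- monotone convergence.
    have htrunc : ∀ M : ℕ, ∫⁻ ω, min (f m ω) M ∂P ≤ (∫⁻ ω, upperRate f ω ∂P) * m := fun M => by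
      have hgm : Measurable fun ω => min (f m ω) (M : ℝ≥0∞) := (hf m).min measurable_const
      set g : ℕ → Ω → ℝ≥0∞ := fun k ω =>
        birkhoffSum θ^[m] (fun ω => min (f m ω) (M : ℝ≥0∞)) k ω / k with hg
      have hgk : ∀ k, Measurable (g k) := fun k =>
        (measurable_birkhoffSum (hθ.iterate m).measurable hgm k).div_const _
      have hgint : ∀ k : ℕ, 1 ≤ k → ∫⁻ ω, g k ω ∂P = ∫⁻ ω, min (f m ω) M ∂P := fun k hk => by
        have hk0 : (k : ℝ≥0∞) ≠ 0 := by simp; omega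
        have hkt : (k : ℝ≥0∞) ≠ ∞ := by simp
        simp only [hg, div_eq_mul_inv]
        rw [lintegral_mul_const _ (measurable_birkhoffSum (hθ.iterate m).measurable hgm k),
          lintegral_birkhoffSum (hθ.iterate m) hgm, mul_comm, ← mul_assoc,
          ENNReal.inv_mul_cancel hk0 hkt, one_mul]
      have hgle : ∀ k ω, g k ω ≤ M := fun k ω => by
        refine ENNReal.div_le_of_le_mul ?_
        refine (Finset.sum_le_card_nsmul _ _ (M : ℝ≥0∞) fun i _ => min_le_right _ _).trans ?_
        simp [mul_comm]
      have hglim : ∀ ω, limsup (fun k => g k ω) atTop ≤ upperRate f ω * m := fun ω => by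
        have hsub : Tendsto (fun k : ℕ => m * k) atTop atTop :=
          tendsto_id.const_mul_atTop' (by omega)
        calc limsup (fun k => g k ω) atTop
            ≤ limsup (fun k : ℕ => m * (f (m * k) ω / (m * k : ℕ))) atTop := by
              refine limsup_le_limsup ?_
              filter_upwards [eventually_ge_atTop 1] with k hk
              have hk0 : (k : ℝ≥0∞) ≠ 0 := by simp; omega
              have : (m : ℝ≥0∞) * (f (m * k) ω / (m * k : ℕ)) = f (m * k) ω / k := by
                rw [Nat.cast_mul, ← mul_div_assoc, ENNReal.mul_div_mul_left _ _ h0 ht]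
              rw [this]
              refine ENNReal.div_le_div_right (le_trans ?_ (hs.birkhoffSum_le m k ω)) _
              exact Finset.sum_le_sum fun i _ => min_le_left _ _
          _ = m * limsup (fun k : ℕ => f (m * k) ω / (m * k : ℕ)) atTop :=
              ENNReal.limsup_const_mul_of_ne_top ht
          _ ≤ m * upperRate f ω := by
              gcongr
              exact limsup_le_limsup_of_le (f := map (fun k : ℕ => m * k) atTop)
                (u := fun n : ℕ => f n ω / n) hsub
          _ = _ := mul_comm _ _
      calc ∫⁻ ω, min (f m ω) M ∂P = limsup (fun k => ∫⁻ ω, g k ω ∂P) atTop := by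
            refine (Tendsto.limsup_eq (tendsto_const_nhds.congr' ?_)).symm
            filter_upwards [eventually_ge_atTop 1] with k hk
            exact (hgint k hk).symm
        _ ≤ ∫⁻ ω, limsup (fun k => g k ω) atTop ∂P :=
            limsup_lintegral_le (fun _ => (M : ℝ≥0∞)) hgk
              (fun k => Eventually.of_forall (hgle k)) (by simp)
        _ ≤ ∫⁻ ω, upperRate f ω * m ∂P := lintegral_mono hglim
        _ = _ := lintegral_mul_const _ (measurable_upperRate hf)
    have hsup : ∀ x : ℝ≥0∞, ⨆ M : ℕ, min x M = x := fun x => by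
      rw [← inf_iSup_eq, ENNReal.iSup_natCast, inf_top_eq]
    calc ∫⁻ ω, f m ω ∂P = ∫⁻ ω, ⨆ M : ℕ, min (f m ω) M ∂P := by simp only [hsup]
      _ = ⨆ M : ℕ, ∫⁻ ω, min (f m ω) M ∂P :=
          lintegral_iSup (fun M => (hf m).min measurable_const) fun M N hMN ω => by
            dsimp only
            gcongr
      _ ≤ _ := iSup_le htrunc

/-- A measurable function that does not increase along a measure preserving map has an exactly
invariant measurable version. -/
theorem exists_invariant_ae_eq_of_comp_le [IsFiniteMeasure P] (hθ : MeasurePreserving θ P P)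
    {G : Ω → ℝ≥0∞} (hG : Measurable G) (hle : ∀ ω, G (θ ω) ≤ G ω) :
    ∃ F : Ω → ℝ≥0∞, Measurable F ∧ (∀ ω, F (θ ω) = F ω) ∧ F =ᵐ[P] G := by
  -- Along an orbit `G` is antitone, so dropping the first term leaves the infimum unchanged.
  refine ⟨fun ω => ⨅ i : ℕ, G (θ^[i] ω), .iInf fun i => hG.comp (hθ.measurable.iterate i),
    fun ω => ?_, ?_⟩
  · have hanti : Antitone fun i : ℕ => G (θ^[i] ω) := antitone_nat_of_succ_le fun i => by
      rw [Function.iterate_succ_apply']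
      exact hle _
    simpa only [← Function.iterate_succ_apply] using hanti.iInf_nat_add 1
  · filter_upwards [ae_forall_iterate_eq_of_comp_le hθ hG hle] with ω hω
    simp [hω]

end Kingman

/-! ### Trace norm contraction and submultiplicativity of `kappaTr`. -/

section TraceNorm

open scoped ComplexOrder MatrixOrder Matrix.Norms.L2Operator

variable {d : ℕ}

theorem traceNorm_zero : traceNorm (0 : Mat d) = 0 := by simp [traceNorm]

theorem traceNorm_nonneg (X : Mat d) : 0 ≤ traceNorm X :=
  (Complex.le_def.1 (Matrix.nonneg_iff_posSemidef.1 (CFC.abs_nonneg X)).trace_nonneg).1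

theorem traceNorm_pos {X : Mat d} (hX : X ≠ 0) : 0 < traceNorm X := by
  refine lt_of_le_of_ne (traceNorm_nonneg X) fun h => hX ?_
  have hpsd := Matrix.nonneg_iff_posSemidef.1 (CFC.abs_nonneg X)
  have h1 : (CFC.abs X).trace = 0 := by
    have h2 := Complex.le_def.1 hpsd.trace_nonneg
    exact Complex.ext h.symm h2.2.symm
  exact CFC.abs_eq_zero_iff.1 (hpsd.trace_eq_zero_iff.1 h1)

theorem traceNorm_eq_sum_abs_eigenvalues {Y : Mat d} (hY : Y.IsHermitian) :
    traceNorm Y = ∑ i, |hY.eigenvalues i| := by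
  have h : CFC.abs Y = cfc (fun x : ℝ => |x|) Y := by
    simpa using CFC.abs_eq_cfc_norm Y hY
  rw [traceNorm, h, hY.cfc_eq, Matrix.IsHermitian.cfc, Unitary.conjStarAlgAut_apply,
    Matrix.trace_mul_cycle, Unitary.coe_star_mul_self, one_mul, Matrix.trace_diagonal]
  simp

/-- In an eigenbasis of `A - B`, each eigenvalue is a difference of nonnegative diagonal entries of
`A` and `B`, and these entries sum to the traces. -/
theorem traceNorm_sub_le {A B : Mat d} (hA : A.PosSemidef) (hB : B.PosSemidef) :
    traceNorm (A - B) ≤ A.trace.re + B.trace.re := by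
  have hY : (A - B).IsHermitian := hA.isHermitian.sub hB.isHermitian
  rw [traceNorm_eq_sum_abs_eigenvalues hY]
  set U : Mat d := (hY.eigenvectorUnitary : Mat d) with hU
  have htr : ∀ C : Mat d, ∑ i, ((star U * C * U) i i).re = C.trace.re := fun C => by
    rw [← Complex.re_sum]
    change (Matrix.trace (star U * C * U)).re = _
    rw [Matrix.trace_mul_cycle, hU, ← Unitary.coe_star, Unitary.coe_mul_star_self, one_mul]
  have hpos : ∀ {C : Mat d}, C.PosSemidef → ∀ i, 0 ≤ ((star U * C * U) i i).re := fun hC i =>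
    (Complex.le_def.1 ((hC.conjTranspose_mul_mul_same U).diag_nonneg (i := i))).1
  have heig : ∀ i, hY.eigenvalues i = ((star U * A * U) i i).re - ((star U * B * U) i i).re := by
    intro i
    have h := hY.conjStarAlgAut_star_eigenvectorUnitary
    rw [Unitary.conjStarAlgAut_star_apply] at h
    have h2 := congrArg (fun M : Mat d => (M i i).re) h
    simp only [mul_sub, sub_mul, Matrix.sub_apply, Complex.sub_re] at h2
    simpa using h2.symm
  rw [← htr A, ← htr B, ← Finset.sum_add_distrib]
  refine Finset.sum_le_sum fun i _ => ?_
  rw [heig]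
  refine (abs_sub _ _).trans ?_
  rw [abs_of_nonneg (hpos hA i), abs_of_nonneg (hpos hB i)]

/-- Positive trace preserving maps. -/
def IsPosTP (T : SuperOp d) : Prop :=
  (∀ X : Mat d, X.PosSemidef → (T X).PosSemidef) ∧ ∀ X : Mat d, (T X).trace = X.trace

theorem IsCPTP.isPosTP {T : SuperOp d} (hT : IsCPTP T) : IsPosTP T := by
  obtain ⟨⟨Ψ, rfl⟩, h⟩ := hT
  refine ⟨fun X hX => ?_, h⟩
  rw [← Matrix.nonneg_iff_posSemidef] at hX ⊢
  exact map_nonneg Ψ hX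

theorem isPosTP_id : IsPosTP (LinearMap.id : SuperOp d) := ⟨fun _ h => h, fun _ => rfl⟩

theorem IsPosTP.comp {S T : SuperOp d} (hS : IsPosTP S) (hT : IsPosTP T) : IsPosTP (S ∘ₗ T) :=
  ⟨fun X hX => hS.1 _ (hT.1 X hX), fun X => (hS.2 _).trans (hT.2 X)⟩

theorem exists_posSemidef_sub {X : Mat d} (hX : X.IsHermitian) :
    ∃ A B : Mat d, A.PosSemidef ∧ B.PosSemidef ∧ X = A - B ∧
      traceNorm X = A.trace.re + B.trace.re := by
  have hX' : IsSelfAdjoint X := hX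
  refine ⟨X⁺, X⁻, Matrix.nonneg_iff_posSemidef.1 (CFC.posPart_nonneg X),
    Matrix.nonneg_iff_posSemidef.1 (CFC.negPart_nonneg X), (CFC.posPart_sub_negPart X hX').symm, ?_⟩
  rw [traceNorm, ← CFC.posPart_add_negPart X hX', Matrix.trace_add, Complex.add_re]

theorem IsPosTP.isHermitian {T : SuperOp d} (hT : IsPosTP T) {X : Mat d} (hX : X.IsHermitian) :
    (T X).IsHermitian := by
  obtain ⟨A, B, hA, hB, rfl, -⟩ := exists_posSemidef_sub hX
  rw [map_sub]
  exact (hT.1 A hA).isHermitian.sub (hT.1 B hB).isHermitian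

theorem IsPosTP.traceNorm_le {T : SuperOp d} (hT : IsPosTP T) {X : Mat d} (hX : X.IsHermitian) :
    traceNorm (T X) ≤ traceNorm X := by
  obtain ⟨A, B, hA, hB, rfl, h⟩ := exists_posSemidef_sub hX
  rw [h, map_sub, ← hT.2 A, ← hT.2 B]
  exact traceNorm_sub_le (hT.1 A hA) (hT.1 B hB)

theorem IsPosTP.kappaTr_le_one {T : SuperOp d} (hT : IsPosTP T) : kappaTr T ≤ 1 :=
  iSup_le fun X => ENNReal.ofReal_le_one.2 <|
    div_le_one_of_le₀ (hT.traceNorm_le X.2.1) (traceNorm_nonneg _)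

/-- `T X` is again Hermitian and traceless, hence a competitor for `kappaTr S` unless it vanishes.
-/
theorem kappaTr_comp_le {S T : SuperOp d} (hT : IsPosTP T) :
    kappaTr (S ∘ₗ T) ≤ kappaTr S * kappaTr T := by
  refine iSup_le fun X => ?_
  rcases eq_or_ne (T X.1) 0 with h0 | h0
  · simp [h0, traceNorm_zero]
  · have hpos := traceNorm_pos h0
    have hsplit : traceNorm (S (T X.1)) / traceNorm X.1
        = traceNorm (S (T X.1)) / traceNorm (T X.1) * (traceNorm (T X.1) / traceNorm X.1) := by
      rw [div_mul_div_cancel₀ hpos.ne']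
    rw [LinearMap.comp_apply, hsplit,
      ENNReal.ofReal_mul (div_nonneg (traceNorm_nonneg _) (traceNorm_nonneg _))]
    exact mul_le_mul'
      (le_iSup (fun Y : {X : Mat d // X.IsHermitian ∧ X.trace = 0 ∧ X ≠ 0} =>
        ENNReal.ofReal (traceNorm (S Y.1) / traceNorm Y.1))
        ⟨T X.1, hT.isHermitian X.2.1, (hT.2 _).trans X.2.2.1, h0⟩)
      (le_iSup (fun Y : {X : Mat d // X.IsHermitian ∧ X.trace = 0 ∧ X ≠ 0} =>
        ENNReal.ofReal (traceNorm (T Y.1) / traceNorm Y.1)) X)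

end TraceNorm

/-! ### Measurability of `kappaTr`. -/

open scoped MatrixOrder Matrix.Norms.L2Operator in
theorem continuous_cfcAbs {d : ℕ} : Continuous fun X : Mat d => CFC.abs X :=
  CFC.continuous_abs

theorem continuous_traceNorm {d : ℕ} : Continuous (traceNorm : Mat d → ℝ) :=
  Complex.continuous_re.comp continuous_cfcAbs.matrix_trace

/-- `kappaTr` in terms of the matrix entries of the images of the matrix units. -/
noncomputable def kappaTrOfCoords {d : ℕ} (t : Fin d × Fin d × Fin d × Fin d → ℂ) : ℝ≥0∞ :=
  ⨆ X : {X : Mat d // X.IsHermitian ∧ X.trace = 0 ∧ X ≠ 0},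
    ENNReal.ofReal (traceNorm (Matrix.of fun i j => ∑ k, ∑ l, X.1 k l * t (k, l, i, j))
      / traceNorm X.1)

/-- The supremum is uncountable, so measurability comes from lower semicontinuity of a supremum of
continuous functions. -/
theorem lowerSemicontinuous_kappaTrOfCoords {d : ℕ} :
    LowerSemicontinuous (kappaTrOfCoords (d := d)) := by
  refine lowerSemicontinuous_iSup fun X => Continuous.lowerSemicontinuous ?_
  have h : Continuous fun t : Fin d × Fin d × Fin d × Fin d → ℂ =>
      (Matrix.of fun i j => ∑ k, ∑ l, X.1 k l * t (k, l, i, j) : Mat d) :=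
    continuous_matrix fun i j => by
      simp only [Matrix.of_apply]
      fun_prop
  exact ENNReal.continuous_ofReal.comp ((continuous_traceNorm.comp h).div_const _)

/-! ### Cocycle identity and measurability of the forward products. -/

section ForwardProduct

variable {Ω : Type*} {d : ℕ} {θ : Ω → Ω} {Φ : Ω → SuperOp d}

theorem isPosTP_forwardProduct (hΦ : ∀ ω, IsPosTP (Φ ω)) (n : ℕ) (ω : Ω) :
    IsPosTP (forwardProduct θ Φ n ω) := by
  induction n with
  | zero => exact isPosTP_id
  | succ n ih => exact (hΦ _).comp ih

theorem forwardProduct_add (m n : ℕ) (ω : Ω) :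
    forwardProduct θ Φ (m + n) ω
      = forwardProduct θ Φ n (θ^[m] ω) ∘ₗ forwardProduct θ Φ m ω := by
  induction n with
  | zero => rfl
  | succ n ih =>
    rw [← add_assoc, forwardProduct, ih, forwardProduct, LinearMap.comp_assoc,
      ← Function.iterate_add_apply, add_comm n m]

theorem SuperOp.apply_eq_sum (T : SuperOp d) (Y : Mat d) (i j : Fin d) :
    T Y i j = ∑ k, ∑ l, Y k l * T (Matrix.single k l 1) i j := by
  conv_lhs => rw [Matrix.matrix_eq_sum_single Y]
  simp only [map_sum, Matrix.sum_apply]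
  refine Finset.sum_congr rfl fun k _ => Finset.sum_congr rfl fun l _ => ?_
  rw [← mul_one (Y k l), ← smul_eq_mul, ← Matrix.smul_single, map_smul, Matrix.smul_apply]
  simp

variable [MeasurableSpace Ω]

theorem measurable_forwardProduct (hθ : Measurable θ)
    (hΦ : ∀ (X : Mat d) (i j : Fin d), Measurable fun ω => Φ ω X i j) (n : ℕ) (X : Mat d)
    (i j : Fin d) : Measurable fun ω => forwardProduct θ Φ n ω X i j := by
  induction n generalizing i j with
  | zero => exact measurable_const
  | succ n ih =>
    simp only [forwardProduct, LinearMap.comp_apply]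
    simp only [SuperOp.apply_eq_sum (Φ _) (forwardProduct θ Φ n _ X)]
    exact Finset.measurable_fun_sum _ fun k _ => Finset.measurable_fun_sum _ fun l _ =>
      (ih k l).mul ((hΦ _ i j).comp (hθ.iterate n))

theorem measurable_kappaTr {T : Ω → SuperOp d}
    (hT : ∀ (X : Mat d) (i j : Fin d), Measurable fun ω => T ω X i j) :
    Measurable fun ω => kappaTr (T ω) := by
  have hKT : (fun ω => kappaTr (T ω))
      = fun ω => kappaTrOfCoords fun p => T ω (Matrix.single p.1 p.2.1 1) p.2.2.1 p.2.2.2 := by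
    funext ω
    refine iSup_congr fun X => ?_
    have hX : T ω X.1 = Matrix.of fun i j =>
        ∑ k, ∑ l, X.1 k l * T ω (Matrix.single k l 1) i j := by
      ext i j
      exact SuperOp.apply_eq_sum (T ω) X.1 i j
    rw [hX]
  rw [hKT]
  exact lowerSemicontinuous_kappaTrOfCoords.measurable.comp
    (measurable_pi_lambda _ fun p => hT _ _ _)

end ForwardProduct

/-! ### Passage between `[0, ∞]` and `[-∞, 0]`. -/

section EReal

theorem EReal.one_div_natCast_mul_neg_coe (x : ℝ≥0∞) {n : ℕ} (hn : 1 ≤ n) :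
    ((1 / (n : ℝ) : ℝ) : EReal) * (-(x : EReal)) = -((x / n : ℝ≥0∞) : EReal) := by
  have hinv : (((n : ℝ≥0∞)⁻¹ : ℝ≥0∞) : EReal) = ((1 / (n : ℝ) : ℝ) : EReal) := by
    have hpos : (0 : ℝ) < n := by exact_mod_cast hn
    rw [← ENNReal.ofReal_natCast, ← ENNReal.ofReal_inv_of_pos hpos, EReal.coe_ennreal_ofReal,
      max_eq_left (by positivity), one_div]
  rw [div_eq_mul_inv x, EReal.coe_ennreal_mul, hinv, mul_neg, mul_comm]

/-- The index family must be nonempty: an empty one would give `0` on the left and `⊤` on the right.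
-/
theorem EReal.neg_coe_iSup₂ {ι : Type*} {p : ι → Prop} (hp : ∃ i, p i)
    (g : ι → ℝ≥0∞) :
    -((⨆ (i) (_ : p i), g i : ℝ≥0∞) : EReal) = ⨅ (i) (_ : p i), -(g i : EReal) := by
  refine le_antisymm (le_iInf₂ fun i hi => ?_) ?_
  · rw [EReal.neg_le_neg_iff, EReal.coe_ennreal_le_coe_ennreal_iff]
    exact le_iSup₂ (f := fun i (_ : p i) => g i) i hi
  · set y : EReal := ⨅ (i) (_ : p i), -(g i : EReal)
    rw [EReal.le_neg]
    have h : ∀ i, p i → (g i : EReal) ≤ -y := fun i hi => by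
      rw [EReal.le_neg]
      exact iInf₂_le i hi
    obtain ⟨i₀, hi₀⟩ := hp
    have hy : 0 ≤ -y := (EReal.coe_ennreal_nonneg _).trans (h i₀ hi₀)
    rw [← EReal.coe_toENNReal hy, EReal.coe_ennreal_le_coe_ennreal_iff]
    refine iSup₂_le fun i hi => ?_
    rw [← EReal.coe_ennreal_le_coe_ennreal_iff, EReal.coe_toENNReal hy]
    exact h i hi

end EReal

/-! ### The process `-log κ_n` and the main theorem. -/

section LogKappa

variable {Ω : Type*} {d : ℕ} {θ : Ω → Ω} {Φ : Ω → SuperOp d}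

/-- The nonnegative process `-log κ_n`. -/
noncomputable def negLogKappa (θ : Ω → Ω) (Φ : Ω → SuperOp d) (n : ℕ) (ω : Ω) : ℝ≥0∞ :=
  (-logKappa θ Φ n ω).toENNReal

theorem logKappa_nonpos (hΦ : ∀ ω, IsPosTP (Φ ω)) (n : ℕ) (ω : Ω) : logKappa θ Φ n ω ≤ 0 :=
  ENNReal.log_le_zero_iff.2 (isPosTP_forwardProduct hΦ n ω).kappaTr_le_one

theorem logKappa_eq_neg (hΦ : ∀ ω, IsPosTP (Φ ω)) (n : ℕ) (ω : Ω) :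
    logKappa θ Φ n ω = -(negLogKappa θ Φ n ω : EReal) := by
  rw [negLogKappa, EReal.coe_toENNReal (EReal.neg_nonneg.2 (logKappa_nonpos hΦ n ω)), neg_neg]

theorem isSuperadditiveProcess_negLogKappa (hΦ : ∀ ω, IsPosTP (Φ ω)) :
    IsSuperadditiveProcess θ (negLogKappa θ Φ) := by
  intro m n ω
  have h1 := logKappa_nonpos (θ := θ) hΦ m ω
  have h2 := logKappa_nonpos (θ := θ) hΦ n (θ^[m] ω)
  have h : logKappa θ Φ (m + n) ω ≤ logKappa θ Φ n (θ^[m] ω) + logKappa θ Φ m ω := by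
    simp only [logKappa]
    rw [← ENNReal.log_mul_add, forwardProduct_add]
    exact ENNReal.log_le_log (kappaTr_comp_le (isPosTP_forwardProduct hΦ m ω))
  -- Neither logarithm is `⊤`, so negation distributes over their sum.
  have ht1 : logKappa θ Φ m ω ≠ ⊤ := (h1.trans_lt EReal.zero_lt_top).ne
  have ht2 : logKappa θ Φ n (θ^[m] ω) ≠ ⊤ := (h2.trans_lt EReal.zero_lt_top).ne
  rw [negLogKappa, negLogKappa, negLogKappa,
    ← EReal.toENNReal_add (EReal.neg_nonneg.2 h1) (EReal.neg_nonneg.2 h2)]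
  refine EReal.toENNReal_le_toENNReal ?_
  rw [← sub_eq_add_neg, ← EReal.neg_add (Or.inr ht2) (Or.inl ht1), EReal.neg_le_neg_iff,
    add_comm (logKappa _ _ _ _)]
  exact h

theorem measurable_negLogKappa [MeasurableSpace Ω] (hθ : Measurable θ)
    (hΦ : ∀ (X : Mat d) (i j : Fin d), Measurable fun ω => Φ ω X i j) (n : ℕ) :
    Measurable (negLogKappa θ Φ n) :=
  (measurable_kappaTr (measurable_forwardProduct hθ hΦ n)).ennreal_log.neg.ereal_toENNReal

end LogKappa

theorem mainTheorem4 {Ω : Type*} [MeasurableSpace Ω] (P : Measure Ω) [IsProbabilityMeasure P]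
    (θ : Ω ≃ᵐ Ω) (hθ : MeasurePreserving θ P P)
    (d : ℕ) (Φ : Ω → SuperOp d)
    (hΦ_cptp : ∀ ω, IsCPTP (Φ ω))
    (hΦ_meas : ∀ (X : Mat d) (i j : Fin d), Measurable fun ω => Φ ω X i j) :
    ∃ lam : Ω → EReal,
      Measurable lam ∧ (∀ ω, lam ω ≤ 0) ∧ (∀ ω, lam (θ ω) = lam ω) ∧
      (∀ᵐ ω ∂P, Tendsto (fun n : ℕ => ((1 / (n : ℝ) : ℝ) : EReal) * logKappa θ Φ n ω)
        atTop (𝓝 (lam ω))) ∧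
      (Ergodic θ P → ∃ c : EReal,
        (∀ᵐ ω ∂P, lam ω = c) ∧
        c = ⨅ (n : ℕ) (_ : 1 ≤ n),
          ((1 / (n : ℝ) : ℝ) : EReal) * nonposExpectation P (logKappa θ Φ n)) := by
  have hΦ : ∀ ω, IsPosTP (Φ ω) := fun ω => (hΦ_cptp ω).isPosTP
  set f := negLogKappa θ Φ
  have hfm : ∀ n, Measurable (f n) := measurable_negLogKappa θ.measurable hΦ_meas
  have hfs : IsSuperadditiveProcess θ f := isSuperadditiveProcess_negLogKappa hΦ
  obtain ⟨F, hFm, hFinv, hFG⟩ :=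
    exists_invariant_ae_eq_of_comp_le hθ (measurable_upperRate hfm) hfs.upperRate_comp_le
  refine ⟨fun ω => -(F ω : EReal), hFm.coe_ereal_ennreal.neg,
    fun ω => by simpa using EReal.neg_le_neg_iff.2 (EReal.coe_ennreal_nonneg (F ω)), fun ω => by simp only [hFinv], ?_, ?_⟩
  · filter_upwards [hfs.ae_tendsto hθ hfm, hFG] with ω hω hFω
    rw [hFω]
    refine Tendsto.congr' ?_
      ((continuous_neg.comp continuous_coe_ennreal_ereal).continuousAt.tendsto.comp hω)
    filter_upwards [eventually_ge_atTop 1] with n hn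
    rw [logKappa_eq_neg hΦ, EReal.one_div_natCast_mul_neg_coe _ hn]
    rfl
  · intro herg
    obtain ⟨c, hc⟩ := herg.ae_eq_const_of_ae_eq_comp₀ hFm.nullMeasurable
      (Eventually.of_forall hFinv)
    refine ⟨-(c : EReal), hc.mono fun ω hω => by simp only [hω, Function.const_apply], ?_⟩
    -- Under a probability measure the constant `c` is its own integral, hence the mean of the upper
    -- rate.
    have hcint : c = ⨆ (n : ℕ) (_ : 1 ≤ n), (∫⁻ ω, f n ω ∂P) / n := by
      rw [← hfs.lintegral_upperRate hθ hfm, ← lintegral_congr_ae hFG, lintegral_congr_ae hc]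
      simp
    rw [hcint, EReal.neg_coe_iSup₂ ⟨1, le_rfl⟩]
    refine iInf_congr fun n => iInf_congr fun hn => ?_
    rw [← EReal.one_div_natCast_mul_neg_coe _ hn]
    rfl
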